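/- \textbf{Setting.} Fix $d,N_1,N_2\in\{1,2,\dots\}$ and $\varepsilon>0$, and let $\Omega=C([0,1];\mathbb R^d)$ carry the uniform topology, its Borel $\sigma$-algebra and the canonical process $x_t(\omega)=\omega(t)$. Let $\alpha^0_i>0$ $(1\le i\le N_1)$ and $\alpha^1_j>0$ $(1\le j\le N_2)$ be weights with $\sum_i\alpha^0_i=\sum_j\alpha^1_j=1$, and let $p^0_i=\mathcal N(m^0_i,\Sigma^0_i)$, $p^1_j=\mathcal N(m^1_j,\Sigma^1_j)$ be Gaussian laws on $\mathbb R^d$ with positive definite covariances. Let $\mathsf R^i$ be the path law on $\Omega$ of $dx_t=\sqrt{\varepsilon}\,dw_t$, $x_0\sim p^0_i$, where $w$ is a standard $d$-dimensional Brownian motion. For probability measures, $\mathrm{KL}(\mu\|\nu)=\int\log\frac{d\mu}{d\nu}\,d\mu$ if $\mu\ll\nu$ and $+\infty$ otherwise. Let $\Pi(\alpha^0,\alpha^1)$ be the set of nonnegative matrices $\pi=(\pi_{ij})$ with $\sum_j\pi_{ij}=\alpha^0_i$ for all $i$ and $\sum_i\pi_{ij}=\alpha^1_j$ for all $j$. Fix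 $\eta\in\Pi(\alpha^0,\alpha^1)$ with $\eta_{ij}>0$ for all $(i,j)$, and put $\mathrm{KL}(\pi\|\eta)=\sum_{i,j}\pi_{ij}\log(\pi_{ij}/\eta_{ij})$ (with $0\log 0=0$). On $(\{1,\dots,N_1\}\times\{1,\dots,N_2\})\times\Omega$ define the labeled reference law $$\bar{\mathsf R}^\eta=\sum_{i,j}\eta_{ij}\,\delta_{(i,j)}\otimes\mathsf R^i .$$ Call a probability measure $\mathsf Q^{ij}$ on $\Omega$ $(i,j)$-admissible if $x_0\sim p^0_i$ and $x_1\sim p^1_j$ under $\mathsf Q^{ij}$, and let $\mathcal A$ be the set of all lifted laws $\sum_{i,j}\pi_{ij}\,\delta_{(i,j)}\otimes\mathsf Q^{ij}$ with $\pi\in\Pi(\alpha^0,\alpha^1)$ and every $\mathsf Q^{ij}$ $(i,j)$-admissible. \textbf{Theorem (An exact lifted reduction).} For every $(i,j)$ there is a unique minimizer $\mathsf P^{ij}$ of $\mathsf Q\mapsto\mathrm{KL}(\mathsf Q\|\mathsf R^i)$ over the $(i,j)$-admissible laws (the pairwise Schr\"odinger bridge between the Gaussians $p^0_i$ and $p^1_j$),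 and $\kappa_{ij}:=\mathrm{KL}(\mathsf P^{ij}\|\mathsf R^i)<\infty$. With $C_{ij}:=\varepsilon\kappa_{ij}$: \begin{enumerate} \item $\displaystyle\inf_{\bar{\mathsf Q}\in\mathcal A}\mathrm{KL}(\bar{\mathsf Q}\|\bar{\mathsf R}^\eta)=\min_{\pi\in\Pi(\alpha^0,\alpha^1)}\Big\{\sum_{i,j}\pi_{ij}\kappa_{ij}+\mathrm{KL}(\pi\|\eta)\Big\}$, and equivalently $\displaystyle\inf_{\bar{\mathsf Q}\in\mathcal A}\varepsilon\,\mathrm{KL}(\bar{\mathsf Q}\|\bar{\mathsf R}^\eta)=\min_{\pi\in\Pi(\alpha^0,\alpha^1)}\Big\{\sum_{i,j}\pi_{ij}C_{ij}+\varepsilon\,\mathrm{KL}(\pi\|\eta)\Big\}$; the minima are attained. \item For every fixed $\pi\in\Pi(\alpha^0,\alpha^1)$, a family $(\mathsf Q^{ij})$ of admissible laws minimizes $\mathrm{KL}\big(\sum_{i,j}\pi_{ij}\delta_{(i,j)}\otimes\mathsf Q^{ij}\,\big\|\,\bar{\mathsf R}^\eta\big)$ among all such families if and only if $\mathsf Q^{ij}=\mathsf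 P^{ij}$ for every active pair, i.e.\ every $(i,j)$ with $\pi_{ij}>0$. \item For every minimizer $\pi^\star$ of the finite-dimensional problem in (1), the lifted law $\sum_{i,j}\pi^\star_{ij}\,\delta_{(i,j)}\otimes\mathsf P^{ij}$ belongs to $\mathcal A$ and minimizes $\mathrm{KL}(\cdot\|\bar{\mathsf R}^\eta)$ over $\mathcal A$. If moreover $\pi^\star_{ij}>0$ for all $(i,j)$, the optimal conditional laws are unique for all pairs: whenever $(\mathsf Q^{ij})$ is a family of admissible laws such that $\sum_{i,j}\pi^\star_{ij}\,\delta_{(i,j)}\otimes\mathsf Q^{ij}$ minimizes $\mathrm{KL}(\cdot\|\bar{\mathsf R}^\eta)$ over $\mathcal A$, then $\mathsf Q^{ij}=\mathsf P^{ij}$ for all $(i,j)$. \end{enumerate} -/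

import Mathlib

open MeasureTheory ProbabilityTheory InformationTheory
open scoped ENNReal

/-- The path space `C([0,1]; ℝᵈ)`, with the topology of uniform convergence. -/
abbrev PathSpace (d : ℕ) : Type := C(unitInterval, EuclideanSpace ℝ (Fin d))

noncomputable instance PathSpace.measurableSpace (d : ℕ) : MeasurableSpace (PathSpace d) :=
  borel (PathSpace d)

instance PathSpace.borelSpace (d : ℕ) : BorelSpace (PathSpace d) := ⟨rfl⟩

/-- `R` is the path law of the uncontrolled diffusion `dx_t = √ε dw_t` with `x_0 ∼ ν`, where `w` is
a standard `d`-dimensional Brownian motion: `x_0` has law `ν`, and for `s ≤ t` the increment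
`x_t - x_s` has law `𝒩(0, ε (t - s) I)` and is independent of the past `(x_u)_{u ≤ s}`.
This determines `R`. -/
structure IsUncontrolledLaw {d : ℕ} (ε : ℝ) (ν : Measure (EuclideanSpace ℝ (Fin d)))
    (R : Measure (PathSpace d)) : Prop where
  isProbabilityMeasure : IsProbabilityMeasure R
  map_initial : R.map (fun ω ↦ ω 0) = ν
  map_increment : ∀ s t : unitInterval, s ≤ t →
    R.map (fun ω ↦ ω t - ω s) =
      multivariateGaussian 0 ((ε * ((t : ℝ) - (s : ℝ))) • (1 : Matrix (Fin d) (Fin d) ℝ))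
  indep_increment : ∀ s t : unitInterval, s ≤ t →
    IndepFun (fun (ω : PathSpace d) (u : Set.Iic s) ↦ ω u) (fun ω ↦ ω t - ω s) R

/-- Path laws with initial marginal `μ` and terminal marginal `ν`. -/
def endpointLaws {d : ℕ} (μ ν : Measure (EuclideanSpace ℝ (Fin d))) :
    Set (Measure (PathSpace d)) :=
  {Q | IsProbabilityMeasure Q ∧ Q.map (fun ω ↦ ω 0) = μ ∧ Q.map (fun ω ↦ ω 1) = ν}

/-- `P` is a Schrödinger bridge from `μ` to `ν` with reference law `R`: it minimizes the relative
entropy with respect to `R` among all path laws with endpoint marginals `μ` and `ν`. -/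
def IsSchrodingerBridge {d : ℕ} (R : Measure (PathSpace d))
    (μ ν : Measure (EuclideanSpace ℝ (Fin d))) (P : Measure (PathSpace d)) : Prop :=
  P ∈ endpointLaws μ ν ∧ IsMinOn (fun Q ↦ klDiv Q R) (endpointLaws μ ν) P

/-- The component couplings `Π(α⁰, α¹)` of two weight vectors. -/
def couplings {N₁ N₂ : ℕ} (α₀ : Fin N₁ → ℝ) (α₁ : Fin N₂ → ℝ) : Set (Fin N₁ → Fin N₂ → ℝ) :=
  {π | (∀ i j, 0 ≤ π i j) ∧ (∀ i, ∑ j, π i j = α₀ i) ∧ (∀ j, ∑ i, π i j = α₁ j)}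

/-- `KL(π ‖ η) = ∑ π_ij log (π_ij / η_ij)`, with `0 log 0 = 0`, for entrywise positive `η`. -/
noncomputable def couplingKL {N₁ N₂ : ℕ} (π η : Fin N₁ → Fin N₂ → ℝ) : ℝ :=
  ∑ i, ∑ j, π i j * Real.log (π i j / η i j)

/-- The lifted law `∑ π_ij δ_(i,j) ⊗ Q^ij` on labels times paths. -/
noncomputable def liftedLaw {d N₁ N₂ : ℕ} (π : Fin N₁ → Fin N₂ → ℝ)
    (Q : Fin N₁ → Fin N₂ → Measure (PathSpace d)) :
    Measure ((Fin N₁ × Fin N₂) × PathSpace d) :=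
  ∑ i, ∑ j, ENNReal.ofReal (π i j) • (Measure.dirac (i, j)).prod (Q i j)

/-- Families of component path laws `Q^ij` with `x_0 ∼ p⁰_i` and `x_1 ∼ p¹_j` under `Q^ij`. -/
def componentFamilies {d N₁ N₂ : ℕ} (p₀ : Fin N₁ → Measure (EuclideanSpace ℝ (Fin d)))
    (p₁ : Fin N₂ → Measure (EuclideanSpace ℝ (Fin d))) :
    Set (Fin N₁ → Fin N₂ → Measure (PathSpace d)) :=
  {Q | ∀ i j, Q i j ∈ endpointLaws (p₀ i) (p₁ j)}

/-- The admissible lifted class: all `∑ π_ij δ_(i,j) ⊗ Q^ij` with `π ∈ Π(α⁰, α¹)` and `Q^ij`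
satisfying the component endpoint constraints. -/
def admissibleLifts {d N₁ N₂ : ℕ} (α₀ : Fin N₁ → ℝ) (α₁ : Fin N₂ → ℝ)
    (p₀ : Fin N₁ → Measure (EuclideanSpace ℝ (Fin d)))
    (p₁ : Fin N₂ → Measure (EuclideanSpace ℝ (Fin d))) :
    Set (Measure ((Fin N₁ × Fin N₂) × PathSpace d)) :=
  {Qbar | ∃ π ∈ couplings α₀ α₁, ∃ Q ∈ componentFamilies p₀ p₁, Qbar = liftedLaw π Q}

/-!
The reduction rests on the entropy decomposition `klDiv_liftedLaw`: on labels times paths,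
`KL(∑ π_ij δ_(i,j) ⊗ Q^ij ‖ ∑ η_ij δ_(i,j) ⊗ R^i) = ∑ π_ij KL(Q^ij ‖ R^i) + KL(π ‖ η)`,
because the density of the lifted law on the slice `(i, j)` is `π_ij / η_ij` times the density of
`Q^ij` with respect to `R^i`. For a fixed coupling the right-hand side is minimized by minimizing
each active term separately, that is, by the pairwise Schrödinger bridges; what remains is the
finite-dimensional problem, which is a continuous problem on the compact polytope of couplings.

The pairwise bridges are obtained without solving the Schrödinger system.
`exists_isMinOn_klDiv` and `eq_of_isMinOn_klDiv` give existence and uniqueness of the entropy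
minimizer over any set of probability measures that is closed under midpoints and setwise limits and
contains a law of finite entropy. The mechanism is a uniform convexity estimate,
`klDiv_midpoint_gap`: the entropy gap at a midpoint controls the squared `L²` distance of the
square roots of the densities. A minimizing sequence of square-root densities is therefore Cauchy in
`L²`, its limit stays in the constraint set, and Fatou's lemma gives lower semicontinuity of the
entropy.

A law of finite entropy with Gaussian endpoints comes from reweighting the uncontrolled law by
`q(x₁) / k(x₁ - x₀)`, where `q` is the density of the terminal Gaussian and `k` that of the total
displacement. This makes the endpoints independent, and the logarithm of the weight has a quadratic
upper bound, which is integrable because Gaussian measures have second moments.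
-/

/-! ### Information projections -/

/-- The Bregman divergence of `klFun` dominates the squared Hellinger distance. -/
lemma sq_sqrt_sub_le_klFun_bregman {a m : ℝ} (ha : 0 ≤ a) (hm : 0 < m) :
    (√a - √m) ^ 2 ≤ klFun a - klFun m - Real.log m * (a - m) := by
  have h1 := Real.sq_sqrt ha
  have h2 := Real.sq_sqrt hm.le
  rcases ha.eq_or_lt with rfl | ha'
  · simp only [klFun_apply, Real.sqrt_zero, Real.log_zero]
    nlinarith
  · have hsa := Real.sqrt_pos.2 ha'
    have hsm := Real.sqrt_pos.2 hm
    have h := Real.log_le_sub_one_of_pos (div_pos hsm hsa)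
    rw [Real.log_div hsm.ne' hsa.ne', Real.log_sqrt hm.le, Real.log_sqrt ha] at h
    have h3 : 2 * a * (√m / √a - 1) = 2 * (√a * √m) - 2 * a := by
      rw [mul_sub, mul_div_assoc', mul_one]
      congr 1
      rw [div_eq_iff hsa.ne']
      linear_combination 2 * √m * (-h1)
    have h4 := mul_le_mul_of_nonneg_left h (by positivity : 0 ≤ 2 * a)
    rw [h3] at h4
    simp only [klFun_apply]
    nlinarith

/-- Uniform convexity of `klFun`: the midpoint gap controls the squared Hellinger distance. -/
lemma klFun_midpoint_gap {a b : ℝ} (ha : 0 ≤ a) (hb : 0 ≤ b) :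
    (√a - √b) ^ 2 / 2 + 2 * klFun ((a + b) / 2) ≤ klFun a + klFun b := by
  rcases (add_nonneg ha hb).eq_or_lt with h | h
  · obtain rfl : a = 0 := by linarith
    obtain rfl : b = 0 := by linarith
    simp [klFun_zero]
    norm_num
  · have h1 := sq_sqrt_sub_le_klFun_bregman ha (half_pos h)
    have h2 := sq_sqrt_sub_le_klFun_bregman hb (half_pos h)
    nlinarith [sq_nonneg ((√a - √((a + b) / 2)) + (√b - √((a + b) / 2)))]

section Density

open Filter Topology

variable {Ω : Type*} [MeasurableSpace Ω]

/-- The square root of the density of `Q` with respect to `R`, a unit vector of `L²(R)` when `Q` is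
an absolutely continuous probability measure. -/
noncomputable def sqrtDensity (Q R : Measure Ω) (x : Ω) : ℝ := √((Q.rnDeriv R x).toReal)

lemma measurable_sqrtDensity (Q R : Measure Ω) : Measurable (sqrtDensity Q R) :=
  (Measure.measurable_rnDeriv Q R).ennreal_toReal.sqrt

/-- No integrability of the log-density is assumed: without it both sides are infinite. -/
lemma klDiv_withDensity (R : Measure Ω) [IsFiniteMeasure R] {f : Ω → ℝ} (hf : Measurable f)
    (hf0 : ∀ x, 0 ≤ f x) [IsFiniteMeasure (R.withDensity fun x ↦ ENNReal.ofReal (f x))] :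
    klDiv (R.withDensity fun x ↦ ENNReal.ofReal (f x)) R
      = ∫⁻ x, ENNReal.ofReal (klFun (f x)) ∂ R := by
  rw [klDiv_eq_lintegral_klFun_of_ac (withDensity_absolutelyContinuous _ _)]
  refine lintegral_congr_ae ?_
  filter_upwards [Measure.rnDeriv_withDensity R hf.ennreal_ofReal] with x hx
  rw [hx, ENNReal.toReal_ofReal (hf0 x)]

lemma withDensity_ofReal_rnDeriv {Q R : Measure Ω} [IsFiniteMeasure Q] [IsFiniteMeasure R]
    (h : Q ≪ R) : R.withDensity (fun x ↦ ENNReal.ofReal (Q.rnDeriv R x).toReal) = Q := by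
  conv_rhs => rw [← Measure.withDensity_rnDeriv_eq Q R h]
  refine withDensity_congr_ae ?_
  filter_upwards [Measure.rnDeriv_lt_top Q R] with x hx
  rw [ENNReal.ofReal_toReal hx.ne]

lemma withDensity_sqrtDensity_sq {Q R : Measure Ω} [IsFiniteMeasure Q] [IsFiniteMeasure R]
    (h : Q ≪ R) : R.withDensity (fun x ↦ ENNReal.ofReal (sqrtDensity Q R x ^ 2)) = Q := by
  simp_rw [sqrtDensity, Real.sq_sqrt ENNReal.toReal_nonneg]
  exact withDensity_ofReal_rnDeriv h

lemma klDiv_eq_lintegral_sqrtDensity {Q R : Measure Ω} [IsFiniteMeasure Q] [IsFiniteMeasure R]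
    (h : Q ≪ R) :
    klDiv Q R = ∫⁻ x, ENNReal.ofReal (klFun (sqrtDensity Q R x ^ 2)) ∂ R := by
  simp_rw [sqrtDensity, Real.sq_sqrt ENNReal.toReal_nonneg]
  exact klDiv_eq_lintegral_klFun_of_ac h

lemma ofReal_klFun_midpoint_gap {a b : ℝ} (ha : 0 ≤ a) (hb : 0 ≤ b) :
    ENNReal.ofReal ((√a - √b) ^ 2 / 2) + 2 * ENNReal.ofReal (klFun ((a + b) / 2))
      ≤ ENNReal.ofReal (klFun a) + ENNReal.ofReal (klFun b) := by
  have := klFun_nonneg (by positivity : 0 ≤ (a + b) / 2)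
  rw [← ENNReal.ofReal_add (klFun_nonneg ha) (klFun_nonneg hb),
    show (2 : ℝ≥0∞) = ENNReal.ofReal 2 by simp, ← ENNReal.ofReal_mul (by norm_num),
    ← ENNReal.ofReal_add (by positivity) (by positivity)]
  exact ENNReal.ofReal_le_ofReal (klFun_midpoint_gap ha hb)

/-- A parallelogram-type inequality for the relative entropy: the squared Hellinger distance of two
measures is controlled by the entropy gap at their midpoint. -/
lemma klDiv_midpoint_gap {P Q R : Measure Ω} [IsFiniteMeasure P] [IsFiniteMeasure Q]
    [IsFiniteMeasure R] (hP : P ≪ R) (hQ : Q ≪ R) :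
    (∫⁻ x, ENNReal.ofReal ((sqrtDensity P R x - sqrtDensity Q R x) ^ 2 / 2) ∂ R)
      + 2 * klDiv ((2⁻¹ : ℝ≥0∞) • (P + Q)) R ≤ klDiv P R + klDiv Q R := by
  set f := fun x ↦ (P.rnDeriv R x).toReal with hf
  set g := fun x ↦ (Q.rnDeriv R x).toReal with hg
  have hfm : Measurable f := (Measure.measurable_rnDeriv P R).ennreal_toReal
  have hgm : Measurable g := (Measure.measurable_rnDeriv Q R).ennreal_toReal
  have hf0 : ∀ x, 0 ≤ f x := fun x ↦ ENNReal.toReal_nonneg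
  have hg0 : ∀ x, 0 ≤ g x := fun x ↦ ENNReal.toReal_nonneg
  have hmid : (2⁻¹ : ℝ≥0∞) • (P + Q)
      = R.withDensity (fun x ↦ ENNReal.ofReal ((f x + g x) / 2)) := by
    conv_lhs => rw [← withDensity_ofReal_rnDeriv hP, ← withDensity_ofReal_rnDeriv hQ]
    rw [← withDensity_add_left (by fun_prop), ← withDensity_smul _ (by fun_prop)]
    congr 1
    ext x
    simp only [Pi.smul_apply, Pi.add_apply, smul_eq_mul]
    rw [← ENNReal.ofReal_add (hf0 x) (hg0 x), ENNReal.ofReal_div_of_pos two_pos, div_eq_mul_inv,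
      mul_comm]
    simp
  have hfin : IsFiniteMeasure (R.withDensity (fun x ↦ ENNReal.ofReal ((f x + g x) / 2))) := by
    rw [← hmid]
    exact (P + Q).smul_finite (by simp)
  rw [hmid, klDiv_withDensity R (by fun_prop) (fun x ↦ by have := hf0 x; have := hg0 x; positivity),
    klDiv_eq_lintegral_klFun_of_ac hP, klDiv_eq_lintegral_klFun_of_ac hQ,
    ← lintegral_const_mul _ (by fun_prop), ← lintegral_add_right _ (by fun_prop),
    ← lintegral_add_right _ (by fun_prop)]
  exact lintegral_mono fun x ↦ ofReal_klFun_midpoint_gap (hf0 x) (hg0 x)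

lemma eLpNorm_two_sq (R : Measure Ω) (g : Ω → ℝ) :
    eLpNorm g 2 R ^ 2 = ∫⁻ x, ENNReal.ofReal (g x ^ 2) ∂ R := by
  rw [eLpNorm_eq_lintegral_rpow_enorm_toReal (by simp) (by simp), ← ENNReal.rpow_natCast,
    ← ENNReal.rpow_mul]
  simp only [ENNReal.toReal_ofNat, Nat.cast_ofNat, one_div, isUnit_iff_ne_zero, ne_eq,
    OfNat.ofNat_ne_zero, not_false_eq_true, IsUnit.inv_mul_cancel, ENNReal.rpow_one]
  refine lintegral_congr fun x ↦ ?_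
  rw [← sq_abs, ENNReal.ofReal_pow (abs_nonneg _), ← Real.enorm_eq_ofReal_abs]
  norm_cast

/-- `L²` convergence of functions implies setwise convergence of the measures of squared density. -/
lemma tendsto_withDensity_sq_of_tendsto_eLpNorm {R : Measure Ω} {s : ℕ → Ω → ℝ} {g : Ω → ℝ}
    (hs : ∀ n, AEStronglyMeasurable (s n) R) (hg : MemLp g 2 R)
    (h : Tendsto (fun n ↦ eLpNorm (s n - g) 2 R) atTop (𝓝 0)) {A : Set Ω} (hA : MeasurableSet A) :
    Tendsto (fun n ↦ R.withDensity (fun x ↦ ENNReal.ofReal (s n x ^ 2)) A) atTop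
      (𝓝 (R.withDensity (fun x ↦ ENNReal.ofReal (g x ^ 2)) A)) := by
  simp_rw [withDensity_apply _ hA, ← eLpNorm_two_sq]
  refine ENNReal.Tendsto.pow ?_
  have hgA : eLpNorm g 2 (R.restrict A) ≠ ∞ := (hg.restrict A).eLpNorm_ne_top
  have hle : ∀ n, eLpNorm (s n - g) 2 (R.restrict A) ≤ eLpNorm (s n - g) 2 R :=
    fun n ↦ eLpNorm_mono_measure _ Measure.restrict_le_self
  have hgm := hg.aestronglyMeasurable.restrict (s := A)
  have hsm : ∀ n, AEStronglyMeasurable (s n) (R.restrict A) := fun n ↦ (hs n).restrict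
  refine tendsto_of_tendsto_of_tendsto_of_le_of_le
    (g := fun n ↦ eLpNorm g 2 (R.restrict A) - eLpNorm (s n - g) 2 R)
    (h := fun n ↦ eLpNorm g 2 (R.restrict A) + eLpNorm (s n - g) 2 R) ?_ ?_ ?_ ?_
  · simpa using ENNReal.Tendsto.sub tendsto_const_nhds h (Or.inl hgA)
  · simpa using tendsto_const_nhds.add h
  · intro n
    refine tsub_le_iff_right.2 ?_
    calc eLpNorm g 2 (R.restrict A) = eLpNorm (s n + (g - s n)) 2 (R.restrict A) := by simp
      _ ≤ _ := eLpNorm_add_le (hsm n) (hgm.sub (hsm n)) (by norm_num)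
      _ ≤ _ := add_le_add_right (by rw [eLpNorm_sub_comm]; exact hle n) _
  · intro n
    calc eLpNorm (s n) 2 (R.restrict A) = eLpNorm (g + (s n - g)) 2 (R.restrict A) := by simp
      _ ≤ _ := eLpNorm_add_le hgm ((hsm n).sub hgm) (by norm_num)
      _ ≤ _ := add_le_add_right (hle n) _

lemma memLp_sqrtDensity {Q R : Measure Ω} [IsFiniteMeasure Q] [IsFiniteMeasure R] (h : Q ≪ R) :
    MemLp (sqrtDensity Q R) 2 R := by
  refine ⟨(measurable_sqrtDensity Q R).aestronglyMeasurable, ?_⟩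
  have : eLpNorm (sqrtDensity Q R) 2 R ^ 2 = Q Set.univ := by
    conv_rhs => rw [← withDensity_sqrtDensity_sq h]
    rw [eLpNorm_two_sq, withDensity_apply _ .univ, Measure.restrict_univ]
  by_contra hc
  rw [not_lt, top_le_iff] at hc
  rw [hc] at this
  exact measure_ne_top Q Set.univ (by rw [← this]; simp)

lemma ac_of_klDiv_ne_top {Q R : Measure Ω} (h : klDiv Q R ≠ ∞) : Q ≪ R :=
  (klDiv_ne_top_iff.1 h).1

/-- Two minimizers of the relative entropy of finite value over a midpoint-convex set of measures
agree. -/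
theorem eq_of_isMinOn_klDiv {R : Measure Ω} [IsFiniteMeasure R] {S : Set (Measure Ω)}
    (hprob : ∀ Q ∈ S, IsProbabilityMeasure Q)
    (hconv : ∀ Q ∈ S, ∀ Q' ∈ S, (2⁻¹ : ℝ≥0∞) • (Q + Q') ∈ S) {P P' : Measure Ω}
    (hP : P ∈ S) (hP' : P' ∈ S) (hmin : IsMinOn (fun Q ↦ klDiv Q R) S P)
    (hmin' : IsMinOn (fun Q ↦ klDiv Q R) S P') (hfin : klDiv P R ≠ ∞) : P = P' := by
  have := hprob P hP
  have := hprob P' hP'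
  have heq : klDiv P' R = klDiv P R := le_antisymm (hmin' hP) (hmin hP')
  have hac := ac_of_klDiv_ne_top hfin
  have hac' := ac_of_klDiv_ne_top (heq ▸ hfin)
  have hgap := klDiv_midpoint_gap hac hac'
  have hmid : klDiv P R ≤ klDiv ((2⁻¹ : ℝ≥0∞) • (P + P')) R := hmin (hconv P hP P' hP')
  have hzero : ∫⁻ x, ENNReal.ofReal ((sqrtDensity P R x - sqrtDensity P' R x) ^ 2 / 2) ∂ R = 0 := by
    have h1 : (∫⁻ x, ENNReal.ofReal ((sqrtDensity P R x - sqrtDensity P' R x) ^ 2 / 2) ∂ R)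
        + 2 * klDiv P R ≤ 0 + 2 * klDiv P R := by
      calc _ ≤ _ := by gcongr
        _ ≤ _ := hgap
        _ = _ := by rw [heq, zero_add, two_mul]
    exact le_antisymm ((ENNReal.add_le_add_iff_right (ENNReal.mul_ne_top (by simp) hfin)).1 h1)
      zero_le
  have hm1 := measurable_sqrtDensity P R
  have hm2 := measurable_sqrtDensity P' R
  rw [lintegral_eq_zero_iff (by fun_prop)] at hzero
  rw [← withDensity_sqrtDensity_sq hac, ← withDensity_sqrtDensity_sq hac']
  refine withDensity_congr_ae ?_
  filter_upwards [hzero] with x hx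
  simp only [Pi.zero_apply, ENNReal.ofReal_eq_zero] at hx
  have : sqrtDensity P R x - sqrtDensity P' R x = 0 := by
    nlinarith [sq_nonneg (sqrtDensity P R x - sqrtDensity P' R x)]
  rw [sub_eq_zero.1 this]

/-- Existence of information projections: if a midpoint-convex set of probability measures that is
closed under setwise limits contains a measure of finite relative entropy, then the relative
entropy attains its minimum there. The square-root densities of a minimizing sequence are Cauchy in
`L²(R)` by uniform convexity, and the entropy is lower semicontinuous by Fatou's lemma. -/
theorem exists_isMinOn_klDiv {R : Measure Ω} [IsFiniteMeasure R] {S : Set (Measure Ω)}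
    (hprob : ∀ Q ∈ S, IsProbabilityMeasure Q)
    (hconv : ∀ Q ∈ S, ∀ Q' ∈ S, (2⁻¹ : ℝ≥0∞) • (Q + Q') ∈ S)
    (hclosed : ∀ (u : ℕ → Measure Ω) (Q : Measure Ω), (∀ n, u n ∈ S) →
      (∀ A, MeasurableSet A → Tendsto (fun n ↦ u n A) atTop (𝓝 (Q A))) → Q ∈ S)
    (hne : ∃ Q ∈ S, klDiv Q R ≠ ∞) :
    ∃ P ∈ S, IsMinOn (fun Q ↦ klDiv Q R) S P ∧ klDiv P R ≠ ∞ := by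
  obtain ⟨Q₀, hQ₀, hQ₀fin⟩ := hne
  set I : ℝ≥0∞ := ⨅ Q ∈ S, klDiv Q R with hI
  have hIle : ∀ Q ∈ S, I ≤ klDiv Q R := fun Q hQ ↦ iInf₂_le Q hQ
  have hIfin : I ≠ ∞ := ne_top_of_le_ne_top hQ₀fin (hIle Q₀ hQ₀)
  set e : ℕ → ℝ≥0∞ := fun n ↦ ((n : ℝ≥0∞) + 1)⁻¹ with he
  have he0 : ∀ n, e n ≠ 0 := fun n ↦ by simp [he]
  have hetend : Tendsto e atTop (𝓝 0) := by
    have := (tendsto_add_atTop_iff_nat 1).2 ENNReal.tendsto_inv_nat_nhds_zero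
    simpa [he] using this
  have hanti : Antitone e := fun m n h ↦ by
    simp only [he]; gcongr
  have hex : ∀ n, ∃ Q ∈ S, klDiv Q R < I + e n := fun n ↦ by
    have h : I < I + e n := ENNReal.lt_add_right hIfin (he0 n)
    simpa [hI, iInf_lt_iff] using h
  choose u huS hu using hex
  have hup : ∀ n, IsProbabilityMeasure (u n) := fun n ↦ hprob _ (huS n)
  have hac : ∀ n, u n ≪ R := fun n ↦ ac_of_klDiv_ne_top (hu n).ne_top
  set s : ℕ → Ω → ℝ := fun n ↦ sqrtDensity (u n) R with hs
  have hsm : ∀ n, Measurable (s n) := fun n ↦ measurable_sqrtDensity _ _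
  have hmem : ∀ n, MemLp (s n) 2 R := fun n ↦ memLp_sqrtDensity (hac n)
  -- a midpoint has entropy at least `I`, so the entropy gap of `u n` and `u m` is at most `2 * e N`
  have hcauchy_aux : ∀ n m N, N ≤ n → N ≤ m → eLpNorm (s n - s m) 2 R ^ 2 ≤ 4 * e N := by
    intro n m N hn hm
    have hgap := klDiv_midpoint_gap (hac n) (hac m)
    have hmid := hIle _ (hconv _ (huS n) _ (huS m))
    have h1 : (∫⁻ x, ENNReal.ofReal ((s n x - s m x) ^ 2 / 2) ∂ R) + 2 * I
        ≤ 2 * e N + 2 * I := by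
      calc _ ≤ _ := by gcongr
        _ ≤ _ := hgap
        _ ≤ (I + e N) + (I + e N) := by
          gcongr
          · exact (hu n).le.trans (by gcongr; exact hanti hn)
          · exact (hu m).le.trans (by gcongr; exact hanti hm)
        _ = _ := by ring
    have h2 := (ENNReal.add_le_add_iff_right (ENNReal.mul_ne_top (by simp) hIfin)).1 h1
    calc eLpNorm (s n - s m) 2 R ^ 2
        = ∫⁻ x, 2 * ENNReal.ofReal ((s n x - s m x) ^ 2 / 2) ∂ R := by
          rw [eLpNorm_two_sq]
          refine lintegral_congr fun x ↦ ?_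
          rw [show (2 : ℝ≥0∞) = ENNReal.ofReal 2 by simp, ← ENNReal.ofReal_mul (by norm_num)]
          congr 1
          simp only [Pi.sub_apply]
          ring
      _ = 2 * ∫⁻ x, ENNReal.ofReal ((s n x - s m x) ^ 2 / 2) ∂ R :=
          lintegral_const_mul _ (by fun_prop)
      _ ≤ 2 * (2 * e N) := by gcongr
      _ = 4 * e N := by ring
  have hcauchy : CauchySeq fun n ↦ (hmem n).toLp (s n) := by
    refine EMetric.cauchySeq_iff_le_tendsto_0.2 ⟨fun N ↦ (4 * e N) ^ (2⁻¹ : ℝ), ?_, ?_⟩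
    · intro n m N hn hm
      rw [Lp.edist_toLp_toLp, ENNReal.le_rpow_inv_iff two_pos]
      exact_mod_cast hcauchy_aux n m N hn hm
    · have h4 : Tendsto (fun N ↦ 4 * e N) atTop (𝓝 0) := by
        simpa using ENNReal.Tendsto.const_mul hetend (Or.inr (by simp : (4 : ℝ≥0∞) ≠ ∞))
      simpa using h4.ennrpow_const (2⁻¹ : ℝ)
  obtain ⟨G, hG⟩ := cauchySeq_tendsto_of_complete hcauchy
  obtain ⟨g, hgm, hGg⟩ : ∃ g : Ω → ℝ, Measurable g ∧ G =ᵐ[R] g :=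
    ⟨_, (Lp.aestronglyMeasurable G).stronglyMeasurable_mk.measurable,
      (Lp.aestronglyMeasurable G).ae_eq_mk⟩
  have hgLp : MemLp g 2 R := (memLp_congr_ae hGg).1 (Lp.memLp G)
  have hconvLp : Tendsto (fun n ↦ eLpNorm (s n - g) 2 R) atTop (𝓝 0) := by
    rw [Lp.tendsto_Lp_iff_tendsto_eLpNorm'] at hG
    refine hG.congr fun n ↦ eLpNorm_congr_ae ?_
    filter_upwards [hGg, (hmem n).coeFn_toLp] with x h1 h2
    simp [h1, h2]
  have hPS : R.withDensity (fun x ↦ ENNReal.ofReal (g x ^ 2)) ∈ S := by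
    refine hclosed u _ huS fun A hA ↦ ?_
    have := tendsto_withDensity_sq_of_tendsto_eLpNorm
      (fun n ↦ (hmem n).aestronglyMeasurable) hgLp hconvLp hA
    refine this.congr fun n ↦ ?_
    rw [hs, withDensity_sqrtDensity_sq (hac n)]
  have hPp := hprob _ hPS
  -- Fatou's lemma along an almost everywhere convergent subsequence
  have hle : klDiv (R.withDensity (fun x ↦ ENNReal.ofReal (g x ^ 2))) R ≤ I := by
    rw [klDiv_withDensity R (by fun_prop) (fun x ↦ sq_nonneg _)]
    obtain ⟨ns, hns, hae⟩ := (tendstoInMeasure_of_tendsto_eLpNorm (by norm_num)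
      (fun n ↦ (hmem n).aestronglyMeasurable) hgLp.aestronglyMeasurable
      hconvLp).exists_seq_tendsto_ae
    calc ∫⁻ x, ENNReal.ofReal (klFun (g x ^ 2)) ∂ R
        = ∫⁻ x, liminf (fun k ↦ ENNReal.ofReal (klFun (s (ns k) x ^ 2))) atTop ∂ R := by
          refine lintegral_congr_ae ?_
          filter_upwards [hae] with x hx
          refine (Tendsto.liminf_eq ?_).symm
          exact (ENNReal.continuous_ofReal.comp
            (continuous_klFun.comp (continuous_pow 2))).continuousAt.tendsto.comp hx
      _ ≤ liminf (fun k ↦ ∫⁻ x, ENNReal.ofReal (klFun (s (ns k) x ^ 2)) ∂ R) atTop :=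
          lintegral_liminf_le fun k ↦ by have := hsm (ns k); fun_prop
      _ ≤ liminf (fun k ↦ I + e (ns k)) atTop := by
          refine liminf_le_liminf (Eventually.of_forall fun k ↦ ?_)
          rw [hs, ← klDiv_eq_lintegral_sqrtDensity (hac _)]
          exact (hu _).le
      _ = I := by
          refine Tendsto.liminf_eq ?_
          simpa using tendsto_const_nhds.add (hetend.comp hns.tendsto_atTop)
  exact ⟨_, hPS, fun Q hQ ↦ hle.trans (hIle Q hQ), ne_top_of_le_ne_top hIfin hle⟩

end Density

/-! ### Densities of nondegenerate Gaussian measures -/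

lemma MeasurableEquiv.map_withDensity {α β : Type*} [MeasurableSpace α] [MeasurableSpace β]
    (e : α ≃ᵐ β) (μ : Measure α) (f : α → ℝ≥0∞) :
    (μ.withDensity f).map e = (μ.map e).withDensity (f ∘ e.symm) := by
  ext s hs
  rw [e.map_apply, withDensity_apply _ (e.measurable hs), withDensity_apply _ hs, e.restrict_map,
    lintegral_map_equiv]
  simp

lemma pi_gaussianReal_eq_withDensity (ι : Type*) [Fintype ι] :
    Measure.pi (fun _ : ι ↦ gaussianReal 0 1)
      = volume.withDensity (fun x : ι → ℝ ↦ ENNReal.ofReal (∏ i, gaussianPDFReal 0 1 (x i))) := by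
  refine Measure.pi_eq fun s hs ↦ ?_
  have hint : ∀ i, Integrable (gaussianPDFReal 0 1) ((volume : Measure ℝ).restrict (s i)) :=
    fun i ↦ (integrable_gaussianPDFReal 0 1).restrict
  rw [withDensity_apply _ (MeasurableSet.univ_pi hs), volume_pi, Measure.restrict_pi_pi,
    ← ofReal_integral_eq_lintegral_ofReal, integral_fintype_prod_eq_prod,
    ENNReal.ofReal_prod_of_nonneg]
  · simp_rw [gaussianReal_apply_eq_integral 0 one_ne_zero]
  · exact fun i _ ↦ integral_nonneg fun x ↦ gaussianPDFReal_nonneg 0 1 x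
  · exact Integrable.fintype_prod hint
  · exact ae_of_all _ fun x ↦ Finset.prod_nonneg fun i _ ↦ gaussianPDFReal_nonneg 0 1 _

lemma stdGaussian_eq_withDensity (ι : Type*) [Fintype ι] :
    stdGaussian (EuclideanSpace ℝ ι) = volume.withDensity (fun x : EuclideanSpace ℝ ι ↦
      ENNReal.ofReal ((√(2 * Real.pi))⁻¹ ^ Fintype.card ι * Real.exp (-‖x‖ ^ 2 / 2))) := by
  have h := (MeasurableEquiv.toLp 2 (ι → ℝ)).map_withDensity volume
    (fun x : ι → ℝ ↦ ENNReal.ofReal (∏ i, gaussianPDFReal 0 1 (x i)))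
  rw [← pi_gaussianReal_eq_withDensity, MeasurableEquiv.coe_toLp, map_pi_eq_stdGaussian,
    (PiLp.volume_preserving_toLp ι).map_eq] at h
  rw [h]
  congr 1
  ext x
  simp only [Function.comp_apply, gaussianPDFReal_def, NNReal.coe_one, mul_one, sub_zero]
  rw [Finset.prod_mul_distrib, Finset.prod_const, ← Real.exp_sum, EuclideanSpace.real_norm_sq_eq,
    Finset.card_univ, ← Finset.sum_div, Finset.sum_neg_distrib]
  rfl

open scoped MatrixOrder in
/-- A nondegenerate Gaussian measure has a bounded density with respect to Lebesgue measure that is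
bounded below by a Gaussian-type function. -/
theorem exists_density_multivariateGaussian {d : ℕ} (m : EuclideanSpace ℝ (Fin d))
    {S : Matrix (Fin d) (Fin d) ℝ} (hS : S.PosDef) :
    ∃ q : EuclideanSpace ℝ (Fin d) → ℝ, Measurable q ∧ (∃ B, ∀ y, q y ≤ B) ∧
      (∃ c > 0, ∃ A ≥ 0, ∀ y, c * Real.exp (-(A * ‖y - m‖ ^ 2)) ≤ q y) ∧
      multivariateGaussian m S = volume.withDensity (fun y ↦ ENNReal.ofReal (q y)) := by
  have hu : IsUnit (Matrix.toEuclideanCLM (𝕜 := ℝ) (CFC.sqrt S)) := by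
    exact IsUnit.map _ hS.isStrictlyPositive.isUnit_cfcSqrt
  obtain ⟨w, hw⟩ := hu
  set e : EuclideanSpace ℝ (Fin d) ≃L[ℝ] EuclideanSpace ℝ (Fin d) :=
    ContinuousLinearEquiv.unitsEquiv ℝ _ w with he
  have hew : ∀ x, Matrix.toEuclideanCLM (𝕜 := ℝ) (CFC.sqrt S) x = e x := fun x ↦ by
    rw [he, ContinuousLinearEquiv.unitsEquiv_apply, hw]
  set a : EuclideanSpace ℝ (Fin d) ≃ᵐ EuclideanSpace ℝ (Fin d) :=
    (e.toHomeomorph.trans (Homeomorph.addLeft m)).toMeasurableEquiv with ha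
  have hacoe : (fun x ↦ m + Matrix.toEuclideanCLM (𝕜 := ℝ) (CFC.sqrt S) x) = a := by
    ext1 x
    rw [hew]
    rfl
  have hasymm : ∀ y, a.symm y = e.symm (y - m) := fun y ↦ by
    rw [MeasurableEquiv.symm_apply_eq, ← hacoe]
    simp [hew]
  have hdet : LinearMap.det (e : EuclideanSpace ℝ (Fin d) →ₗ[ℝ] EuclideanSpace ℝ (Fin d)) ≠ 0 :=
    (LinearEquiv.isUnit_det' e.toLinearEquiv).ne_zero
  obtain ⟨κ, hκ, hvol⟩ : ∃ κ : ℝ, 0 < κ ∧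
      (volume : Measure (EuclideanSpace ℝ (Fin d))).map a = ENNReal.ofReal κ • volume := by
    -- the constant is the inverse of the absolute determinant; translations preserve volume
    refine ⟨_, abs_pos.2 (inv_ne_zero hdet), ?_⟩
    have hcomp : (a : _ → EuclideanSpace ℝ (Fin d)) = (fun x ↦ m + x) ∘
        (e : EuclideanSpace ℝ (Fin d) →ₗ[ℝ] EuclideanSpace ℝ (Fin d)) := rfl
    have hme : Measurable (e : EuclideanSpace ℝ (Fin d) →ₗ[ℝ] EuclideanSpace ℝ (Fin d)) :=
      e.continuous.measurable
    rw [hcomp, ← Measure.map_map (measurable_const_add m) hme,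
      Measure.map_linearMap_addHaar_eq_smul_addHaar _ hdet, Measure.map_smul,
      map_add_left_eq_self]
  set k : ℝ := (√(2 * Real.pi))⁻¹ ^ Fintype.card (Fin d) with hk
  have hk0 : 0 < k := by positivity
  refine ⟨fun y ↦ κ * (k * Real.exp (-‖e.symm (y - m)‖ ^ 2 / 2)), by fun_prop,
    ⟨κ * k, fun y ↦ ?_⟩, ⟨κ * k, by positivity,
      ‖(e.symm : EuclideanSpace ℝ (Fin d) →L[ℝ] EuclideanSpace ℝ (Fin d))‖ ^ 2 / 2, by positivity,
      fun y ↦ ?_⟩, ?_⟩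
  · simp only [← mul_assoc]
    refine mul_le_of_le_one_right (by positivity) (Real.exp_le_one_iff.2 ?_)
    rw [neg_div]
    exact neg_nonpos.2 (by positivity)
  · simp only [mul_assoc]
    gcongr
    have h := (e.symm : EuclideanSpace ℝ (Fin d) →L[ℝ] EuclideanSpace ℝ (Fin d)).le_opNorm (y - m)
    have h2 := pow_le_pow_left₀ (norm_nonneg _) h 2
    rw [mul_pow] at h2
    simp only [ContinuousLinearEquiv.coe_coe] at h2
    linarith
  · rw [multivariateGaussian, hacoe, stdGaussian_eq_withDensity, a.map_withDensity, hvol,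
      withDensity_smul_measure, ← withDensity_smul _ (by fun_prop)]
    congr 1
    ext y
    simp only [Pi.smul_apply, Function.comp_apply, smul_eq_mul, hasymm]
    rw [← ENNReal.ofReal_mul hκ.le]

/-! ### Pairwise Schrödinger bridges -/

section Bridges

open Filter Topology

variable {d : ℕ}

lemma measurable_pathEval (t : unitInterval) : Measurable fun ω : PathSpace d ↦ ω t :=
  (continuous_eval_const t).measurable

lemma midpoint_mem_endpointLaws {μ ν : Measure (EuclideanSpace ℝ (Fin d))}
    {Q Q' : Measure (PathSpace d)} (hQ : Q ∈ endpointLaws μ ν) (hQ' : Q' ∈ endpointLaws μ ν) :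
    (2⁻¹ : ℝ≥0∞) • (Q + Q') ∈ endpointLaws μ ν := by
  obtain ⟨h, h0, h1⟩ := hQ
  obtain ⟨h', h0', h1'⟩ := hQ'
  have hhalf : ∀ {α : Type} [MeasurableSpace α] (ρ : Measure α), (2⁻¹ : ℝ≥0∞) • (ρ + ρ) = ρ := by
    intro α _ ρ
    rw [← two_smul ℝ≥0∞ ρ, smul_smul, ENNReal.inv_mul_cancel (by simp) (by simp), one_smul]
  refine ⟨⟨?_⟩, ?_, ?_⟩
  · simp only [Measure.smul_apply, Measure.add_apply, measure_univ, smul_eq_mul]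
    rw [one_add_one_eq_two, ENNReal.inv_mul_cancel (by simp) (by simp)]
  · rw [Measure.map_smul, Measure.map_add _ _ (measurable_pathEval 0), h0, h0', hhalf]
  · rw [Measure.map_smul, Measure.map_add _ _ (measurable_pathEval 1), h1, h1', hhalf]

lemma mem_endpointLaws_of_tendsto {μ ν : Measure (EuclideanSpace ℝ (Fin d))}
    {u : ℕ → Measure (PathSpace d)} {Q : Measure (PathSpace d)}
    (hu : ∀ n, u n ∈ endpointLaws μ ν)
    (h : ∀ A, MeasurableSet A → Tendsto (fun n ↦ u n A) atTop (𝓝 (Q A))) :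
    Q ∈ endpointLaws μ ν := by
  refine ⟨⟨?_⟩, ?_, ?_⟩
  · refine tendsto_nhds_unique (h _ .univ) (tendsto_const_nhds.congr fun n ↦ ?_)
    have := (hu n).1
    exact measure_univ.symm
  · ext B hB
    rw [Measure.map_apply (measurable_pathEval 0) hB]
    refine tendsto_nhds_unique (h _ (measurable_pathEval 0 hB)) (tendsto_const_nhds.congr fun n ↦ ?_)
    rw [← (hu n).2.1, Measure.map_apply (measurable_pathEval 0) hB]
  · ext B hB
    rw [Measure.map_apply (measurable_pathEval 1) hB]
    refine tendsto_nhds_unique (h _ (measurable_pathEval 1 hB)) (tendsto_const_nhds.congr fun n ↦ ?_)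
    rw [← (hu n).2.2, Measure.map_apply (measurable_pathEval 1) hB]

/-- Under the uncontrolled law the initial position and the total displacement are independent. -/
lemma IsUncontrolledLaw.map_initial_displacement {ε : ℝ} {ν : Measure (EuclideanSpace ℝ (Fin d))}
    {R : Measure (PathSpace d)} (hR : IsUncontrolledLaw ε ν R) :
    R.map (fun ω ↦ (ω 0, ω 1 - ω 0))
      = ν.prod (multivariateGaussian 0 (ε • (1 : Matrix (Fin d) (Fin d) ℝ))) := by
  have := hR.isProbabilityMeasure
  have hind : IndepFun (fun ω : PathSpace d ↦ ω 0) (fun ω ↦ ω 1 - ω 0) R :=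
    (hR.indep_increment 0 1 zero_le_one).comp
      (measurable_pi_apply (⟨0, le_refl (0 : unitInterval)⟩ : Set.Iic (0 : unitInterval)))
      measurable_id
  have hdisp : Measurable fun ω : PathSpace d ↦ ω 1 - ω 0 :=
    (measurable_pathEval 1).sub (measurable_pathEval 0)
  have h := (indepFun_iff_map_prod_eq_prod_map_map (measurable_pathEval 0).aemeasurable
    hdisp.aemeasurable).1 hind
  rw [h, hR.map_initial]
  have h1 := hR.map_increment 0 1 zero_le_one
  simp only [Set.Icc.coe_one, Set.Icc.coe_zero, sub_zero, mul_one] at h1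
  exact congrArg _ h1

/-- Reweighting the uncontrolled law by `q(x₁) / k(x₁ - x₀)`, where `k` is the density of the total
displacement, makes the endpoints independent with terminal density `q`. -/
lemma IsUncontrolledLaw.lintegral_mul_density_ratio {ε : ℝ}
    {ν : Measure (EuclideanSpace ℝ (Fin d))} [SFinite ν] {R : Measure (PathSpace d)}
    (hR : IsUncontrolledLaw ε ν R) {q k : EuclideanSpace ℝ (Fin d) → ℝ} (hq : Measurable q)
    (hk : Measurable k) (hkpos : ∀ z, 0 < k z)
    (hγ : multivariateGaussian 0 (ε • (1 : Matrix (Fin d) (Fin d) ℝ))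
      = volume.withDensity (fun z ↦ ENNReal.ofReal (k z)))
    {F : EuclideanSpace ℝ (Fin d) × EuclideanSpace ℝ (Fin d) → ℝ≥0∞} (hF : Measurable F) :
    ∫⁻ ω, F (ω 0, ω 1) * ENNReal.ofReal (q (ω 1) / k (ω 1 - ω 0)) ∂ R
      = ∫⁻ p, F p ∂(ν.prod (volume.withDensity (fun y ↦ ENNReal.ofReal (q y)))) := by
  have hm0 := measurable_pathEval (d := d) 0
  have hm1 := measurable_pathEval (d := d) 1
  calc ∫⁻ ω, F (ω 0, ω 1) * ENNReal.ofReal (q (ω 1) / k (ω 1 - ω 0)) ∂ R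
      = ∫⁻ p, F (p.1, p.1 + p.2) * ENNReal.ofReal (q (p.1 + p.2) / k p.2)
          ∂(R.map (fun ω ↦ (ω 0, ω 1 - ω 0))) := by
        rw [lintegral_map (by fun_prop) (by fun_prop)]
        simp
    _ = ∫⁻ x, ∫⁻ z, F (x, x + z) * ENNReal.ofReal (q (x + z) / k z)
          ∂(volume.withDensity (fun z ↦ ENNReal.ofReal (k z))) ∂ν := by
        rw [hR.map_initial_displacement, hγ, lintegral_prod _ (by fun_prop)]
    _ = ∫⁻ x, ∫⁻ y, F (x, y) ∂(volume.withDensity (fun y ↦ ENNReal.ofReal (q y))) ∂ν := by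
        refine lintegral_congr fun x ↦ ?_
        rw [lintegral_withDensity_eq_lintegral_mul _ (by fun_prop) (by fun_prop),
          lintegral_withDensity_eq_lintegral_mul _ (by fun_prop) (by fun_prop),
          ← lintegral_add_left_eq_self
            (fun y ↦ ((fun y ↦ ENNReal.ofReal (q y)) * fun y ↦ F (x, y)) y) x]
        refine lintegral_congr fun z ↦ ?_
        simp only [Pi.mul_apply]
        rw [mul_comm (F _), ← mul_assoc, ← ENNReal.ofReal_mul (hkpos z).le,
          mul_div_cancel₀ _ (hkpos z).ne']
    _ = _ := by rw [lintegral_prod _ (by fun_prop)]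

/-- Some path law with the prescribed Gaussian endpoints has finite entropy: the reweighting of the
uncontrolled law with independent endpoints, whose log-density grows at most quadratically. -/
lemma exists_mem_endpointLaws_klDiv_ne_top {ε : ℝ} (hε : 0 < ε) {m₀ m₁ : EuclideanSpace ℝ (Fin d)}
    {S₀ S₁ : Matrix (Fin d) (Fin d) ℝ} (hS₁ : S₁.PosDef) {R : Measure (PathSpace d)}
    (hR : IsUncontrolledLaw ε (multivariateGaussian m₀ S₀) R) :
    ∃ Q ∈ endpointLaws (multivariateGaussian m₀ S₀) (multivariateGaussian m₁ S₁),
      klDiv Q R ≠ ∞ := by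
  have := hR.isProbabilityMeasure
  obtain ⟨q, hq, ⟨B, hB⟩, ⟨c', hc', A', -, hqlow⟩, hqd⟩ :=
    exists_density_multivariateGaussian m₁ hS₁
  obtain ⟨k, hk, -, ⟨c, hc, A, hA, hklow⟩, hkd⟩ :=
    exists_density_multivariateGaussian (0 : EuclideanSpace ℝ (Fin d))
      (Matrix.PosDef.one.smul hε : (ε • (1 : Matrix (Fin d) (Fin d) ℝ)).PosDef)
  have hqpos : ∀ y, 0 < q y := fun y ↦ lt_of_lt_of_le (by positivity) (hqlow y)
  have hkpos : ∀ z, 0 < k z := fun z ↦ lt_of_lt_of_le (by positivity) (hklow z)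
  have hBpos : 0 < B := (hqpos 0).trans_le (hB 0)
  have hm0 := measurable_pathEval (d := d) 0
  have hm1 := measurable_pathEval (d := d) 1
  set h : PathSpace d → ℝ := fun ω ↦ q (ω 1) / k (ω 1 - ω 0) with hh
  have hhm : Measurable h := (hq.comp hm1).div (hk.comp (hm1.sub hm0))
  have hhpos : ∀ ω, 0 < h ω := fun ω ↦ div_pos (hqpos _) (hkpos _)
  set Q := R.withDensity (fun ω ↦ ENNReal.ofReal (h ω)) with hQ
  have hjoint : Q.map (fun ω ↦ (ω 0, ω 1))
      = (multivariateGaussian m₀ S₀).prod (multivariateGaussian m₁ S₁) := by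
    ext s hs
    rw [← lintegral_indicator_one (μ := Measure.prod _ _) hs, hqd,
      ← hR.lintegral_mul_density_ratio hq hk hkpos hkd (measurable_one.indicator hs),
      Measure.map_apply (by fun_prop) hs, hQ, withDensity_apply _ ((hm0.prodMk hm1) hs),
      ← lintegral_indicator ((hm0.prodMk hm1) hs)]
    refine lintegral_congr fun ω ↦ ?_
    by_cases hω : (ω 0, ω 1) ∈ s <;> simp [hω, hh, Set.indicator]
  have h0 : Q.map (fun ω ↦ ω 0) = multivariateGaussian m₀ S₀ := by
    have := congrArg (fun ρ ↦ ρ.map Prod.fst) hjoint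
    simpa [Measure.map_map measurable_fst (hm0.prodMk hm1), Function.comp_def] using this
  have h1 : Q.map (fun ω ↦ ω 1) = multivariateGaussian m₁ S₁ := by
    have := congrArg (fun ρ ↦ ρ.map Prod.snd) hjoint
    simpa [Measure.map_map measurable_snd (hm0.prodMk hm1), Function.comp_def] using this
  have hQp : IsProbabilityMeasure Q := by
    have : IsProbabilityMeasure (Q.map (fun ω ↦ ω 0)) := by rw [h0]; infer_instance
    exact Measure.isProbabilityMeasure_of_map (fun ω ↦ ω 0)
  refine ⟨Q, ⟨hQp, h0, h1⟩, ?_⟩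
  -- a quadratic bound for the positive part of `log h`
  set L : EuclideanSpace ℝ (Fin d) × EuclideanSpace ℝ (Fin d) → ℝ :=
    fun p ↦ |Real.log (B / c)| + 2 * A * (‖p.1‖ ^ 2 + ‖p.2‖ ^ 2) with hL
  have hL0 : ∀ p, 0 ≤ L p := fun p ↦ by positivity
  have hlog : ∀ ω, Real.log (h ω) ≤ L (ω 0, ω 1) := by
    intro ω
    have hle : h ω ≤ B / c * Real.exp (A * ‖ω 1 - ω 0‖ ^ 2) := by
      have := hklow (ω 1 - ω 0)
      rw [sub_zero] at this
      calc h ω ≤ B / (c * Real.exp (-(A * ‖ω 1 - ω 0‖ ^ 2))) := by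
            simp only [hh]
            gcongr
            exact hB _
        _ = _ := by rw [Real.exp_neg]; field_simp
    have hlog := Real.log_le_log (hhpos ω) hle
    rw [Real.log_mul (by positivity) (Real.exp_pos _).ne', Real.log_exp] at hlog
    have hn : ‖ω 1 - ω 0‖ ^ 2 ≤ 2 * (‖ω 0‖ ^ 2 + ‖ω 1‖ ^ 2) := by
      have := norm_sub_le (ω 1) (ω 0)
      nlinarith [sq_nonneg (‖ω 0‖ - ‖ω 1‖), norm_nonneg (ω 1 - ω 0), norm_nonneg (ω 0),
        norm_nonneg (ω 1)]
    have := mul_le_mul_of_nonneg_left hn hA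
    have := le_abs_self (Real.log (B / c))
    simp only [hL]
    linarith
  have hLint : Integrable L
      ((multivariateGaussian m₀ S₀).prod (multivariateGaussian m₁ S₁)) := by
    have hsq : ∀ (m : EuclideanSpace ℝ (Fin d)) (S : Matrix (Fin d) (Fin d) ℝ),
        Integrable (fun x ↦ ‖x‖ ^ 2) (multivariateGaussian m S) := fun m S ↦
      (IsGaussian.memLp_two_id (μ := multivariateGaussian m S)).integrable_norm_pow (by norm_num)
    exact (integrable_const _).add (((hsq m₀ S₀).comp_fst _).add ((hsq m₁ S₁).comp_snd _)
      |>.const_mul _)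
  rw [hQ, klDiv_withDensity R hhm fun ω ↦ (hhpos ω).le]
  -- `klFun h ≤ 1 + h * log h ≤ 1 + L * h`, and `L * h` integrates as `L` under independent endpoints
  refine ne_top_of_le_ne_top ?_ (lintegral_mono (g := fun ω ↦
    1 + ENNReal.ofReal (L (ω 0, ω 1)) * ENNReal.ofReal (h ω)) fun ω ↦ ?_)
  · rw [lintegral_add_left measurable_const, lintegral_one, measure_univ,
      hR.lintegral_mul_density_ratio (F := fun p ↦ ENNReal.ofReal (L p)) hq hk hkpos hkd
        (by fun_prop), ← hqd]
    exact ENNReal.add_ne_top.2 ⟨by simp, hLint.lintegral_lt_top.ne⟩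
  · beta_reduce
    rw [← ENNReal.ofReal_mul (hL0 _), ← ENNReal.ofReal_one, ← ENNReal.ofReal_add zero_le_one
      (mul_nonneg (hL0 _) (hhpos ω).le)]
    refine ENNReal.ofReal_le_ofReal ?_
    rw [klFun_apply]
    have := mul_le_mul_of_nonneg_left (hlog ω) (hhpos ω).le
    linarith [hhpos ω, mul_comm (h ω) (L (ω 0, ω 1))]

/-- Existence of the Gaussian Schrödinger bridge, with finite entropy. -/
theorem exists_isSchrodingerBridge {ε : ℝ} (hε : 0 < ε) {m₀ m₁ : EuclideanSpace ℝ (Fin d)}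
    {S₀ S₁ : Matrix (Fin d) (Fin d) ℝ} (hS₁ : S₁.PosDef) {R : Measure (PathSpace d)}
    (hR : IsUncontrolledLaw ε (multivariateGaussian m₀ S₀) R) :
    ∃ P, IsSchrodingerBridge R (multivariateGaussian m₀ S₀) (multivariateGaussian m₁ S₁) P ∧
      klDiv P R ≠ ∞ := by
  have := hR.isProbabilityMeasure
  obtain ⟨P, hP, hmin, hfin⟩ := exists_isMinOn_klDiv (R := R)
    (S := endpointLaws (multivariateGaussian m₀ S₀) (multivariateGaussian m₁ S₁))
    (fun Q hQ ↦ hQ.1) (fun Q hQ Q' hQ' ↦ midpoint_mem_endpointLaws hQ hQ')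
    (fun u Q hu h ↦ mem_endpointLaws_of_tendsto hu h)
    (exists_mem_endpointLaws_klDiv_ne_top hε hS₁ hR)
  exact ⟨P, ⟨hP, hmin⟩, hfin⟩

lemma IsSchrodingerBridge.klDiv_eq {R P P' : Measure (PathSpace d)}
    {μ ν : Measure (EuclideanSpace ℝ (Fin d))} (hP : IsSchrodingerBridge R μ ν P)
    (hP' : IsSchrodingerBridge R μ ν P') : klDiv P R = klDiv P' R :=
  le_antisymm (hP.2 hP'.1) (hP'.2 hP.1)

lemma IsSchrodingerBridge.unique {R P P' : Measure (PathSpace d)} [IsFiniteMeasure R]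
    {μ ν : Measure (EuclideanSpace ℝ (Fin d))} (hP : IsSchrodingerBridge R μ ν P)
    (hP' : IsSchrodingerBridge R μ ν P') (hfin : klDiv P R ≠ ∞) : P = P' :=
  eq_of_isMinOn_klDiv (fun _ hQ ↦ hQ.1) (fun _ hQ _ hQ' ↦ midpoint_mem_endpointLaws hQ hQ')
    hP.1 hP'.1 hP.2 hP'.2 hfin

end Bridges

/-! ### Entropy of lifted laws -/

/-- Entropy of a rescaled probability measure, at the level of densities. -/
lemma lintegral_klFun_const_mul {Ω : Type*} [MeasurableSpace Ω] {Q R : Measure Ω}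
    [IsProbabilityMeasure Q] [IsProbabilityMeasure R] (h : Q ≪ R) {c : ℝ} (hc : 0 ≤ c) :
    ∫⁻ x, ENNReal.ofReal (klFun (c * (Q.rnDeriv R x).toReal)) ∂ R
      = ENNReal.ofReal c * klDiv Q R + ENNReal.ofReal (klFun c) := by
  set f := fun x ↦ (Q.rnDeriv R x).toReal with hf
  have hfm : Measurable f := (Measure.measurable_rnDeriv Q R).ennreal_toReal
  have hf0 : ∀ x, 0 ≤ f x := fun x ↦ ENNReal.toReal_nonneg
  have hint : ∫⁻ x, ENNReal.ofReal (f x) ∂ R = 1 := by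
    have := congrArg (fun ρ ↦ ρ Set.univ) (withDensity_ofReal_rnDeriv h)
    simpa using this
  -- `A` absorbs the sign of `c * log c`
  set A := |c * Real.log c| with hA
  have hA0 : 0 ≤ A := abs_nonneg _
  have hA1 : 0 ≤ A + c * Real.log c := by linarith [neg_abs_le (c * Real.log c)]
  have hpt : ∀ x, ENNReal.ofReal (klFun (c * f x))
        + (ENNReal.ofReal A * ENNReal.ofReal (f x) + ENNReal.ofReal c)
      = ENNReal.ofReal c * ENNReal.ofReal (klFun (f x))
        + (ENNReal.ofReal (A + c * Real.log c) * ENNReal.ofReal (f x) + 1) := by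
    intro x
    have h1 := klFun_nonneg (mul_nonneg hc (hf0 x))
    have h2 := klFun_nonneg (hf0 x)
    have h3 := hf0 x
    rw [← ENNReal.ofReal_mul hA0, ← ENNReal.ofReal_mul hA1, ← ENNReal.ofReal_mul hc,
      ← ENNReal.ofReal_one, ← ENNReal.ofReal_add (by positivity) hc,
      ← ENNReal.ofReal_add h1 (by positivity), ← ENNReal.ofReal_add (by positivity) zero_le_one,
      ← ENNReal.ofReal_add (by positivity) (by positivity)]
    congr 1
    rcases hc.eq_or_lt with rfl | hc'
    · simp [klFun_zero]; ring
    rcases h3.eq_or_lt with h4 | h4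
    · rw [← h4]; simp [klFun_zero]; ring
    simp only [klFun_apply, Real.log_mul hc'.ne' h4.ne']
    ring
  have hsum := lintegral_congr (μ := R) hpt
  rw [lintegral_add_right _ (by fun_prop), lintegral_add_right _ (by fun_prop),
    lintegral_add_right _ (by fun_prop), lintegral_add_right _ (by fun_prop),
    lintegral_const_mul _ (by fun_prop), lintegral_const_mul _ (by fun_prop),
    lintegral_const_mul _ (by fun_prop), hint, lintegral_const, lintegral_const, measure_univ,
    ← klDiv_eq_lintegral_klFun_of_ac h] at hsum
  simp only [mul_one] at hsum
  have hfin : ENNReal.ofReal A + ENNReal.ofReal c ≠ ∞ := by simp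
  have hc1 : ENNReal.ofReal (A + c * Real.log c) + 1
      = ENNReal.ofReal (klFun c) + (ENNReal.ofReal A + ENNReal.ofReal c) := by
    have := klFun_nonneg hc
    rw [← ENNReal.ofReal_one, ← ENNReal.ofReal_add hA1 zero_le_one, ← ENNReal.ofReal_add hA0 hc,
      ← ENNReal.ofReal_add this (by positivity), klFun_apply]
    congr 1
    ring
  rw [hc1, ← add_assoc (ENNReal.ofReal c * _)] at hsum
  exact (ENNReal.add_left_inj hfin).1 hsum

section Lifted

variable {d N₁ N₂ : ℕ}

lemma lintegral_liftedLaw (π : Fin N₁ → Fin N₂ → ℝ) (Q : Fin N₁ → Fin N₂ → Measure (PathSpace d))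
    [∀ i j, SFinite (Q i j)] {F : (Fin N₁ × Fin N₂) × PathSpace d → ℝ≥0∞} (hF : Measurable F) :
    ∫⁻ p, F p ∂(liftedLaw π Q)
      = ∑ i, ∑ j, ENNReal.ofReal (π i j) * ∫⁻ ω, F ((i, j), ω) ∂(Q i j) := by
  simp only [liftedLaw, lintegral_finsetSum_measure]
  refine Finset.sum_congr rfl fun i _ ↦ Finset.sum_congr rfl fun j _ ↦ ?_
  rw [lintegral_smul_measure, Measure.dirac_prod, lintegral_map hF (by fun_prop), smul_eq_mul]

lemma liftedLaw_apply (π : Fin N₁ → Fin N₂ → ℝ) (Q : Fin N₁ → Fin N₂ → Measure (PathSpace d))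
    [∀ i j, SFinite (Q i j)] {s : Set ((Fin N₁ × Fin N₂) × PathSpace d)} (hs : MeasurableSet s) :
    liftedLaw π Q s = ∑ i, ∑ j, ENNReal.ofReal (π i j) * Q i j (Prod.mk (i, j) ⁻¹' s) := by
  rw [← lintegral_indicator_one hs, lintegral_liftedLaw π Q (measurable_one.indicator hs)]
  refine Finset.sum_congr rfl fun i _ ↦ Finset.sum_congr rfl fun j _ ↦ ?_
  rw [← lintegral_indicator_one (measurable_prodMk_left hs)]
  rfl

lemma isFiniteMeasure_liftedLaw (π : Fin N₁ → Fin N₂ → ℝ)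
    (Q : Fin N₁ → Fin N₂ → Measure (PathSpace d)) [∀ i j, IsProbabilityMeasure (Q i j)] :
    IsFiniteMeasure (liftedLaw π Q) := by
  refine ⟨?_⟩
  rw [liftedLaw_apply π Q .univ]
  simp [ENNReal.sum_lt_top]

variable {α₀ : Fin N₁ → ℝ} {α₁ : Fin N₂ → ℝ} {π η : Fin N₁ → Fin N₂ → ℝ}

/-- The affine part of `klFun` cancels because `π` and `η` have the same total mass. -/
lemma sum_mul_klFun_eq_couplingKL (hπ : π ∈ couplings α₀ α₁) (hη : η ∈ couplings α₀ α₁)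
    (hη_pos : ∀ i j, 0 < η i j) :
    ∑ i, ∑ j, η i j * klFun (π i j / η i j) = couplingKL π η := by
  have hsub : ∑ i, ∑ j, (η i j - π i j) = 0 := by
    simp_rw [Finset.sum_sub_distrib, hπ.2.1, hη.2.1]
    simp
  rw [couplingKL, ← add_zero (∑ i, ∑ j, π i j * Real.log (π i j / η i j)), ← hsub,
    ← Finset.sum_add_distrib]
  refine Finset.sum_congr rfl fun i _ ↦ ?_
  rw [← Finset.sum_add_distrib]
  refine Finset.sum_congr rfl fun j _ ↦ ?_
  have := (hη_pos i j).ne'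
  rw [klFun_apply]
  field_simp
  ring

lemma couplingKL_nonneg (hπ : π ∈ couplings α₀ α₁) (hη : η ∈ couplings α₀ α₁)
    (hη_pos : ∀ i j, 0 < η i j) : 0 ≤ couplingKL π η := by
  rw [← sum_mul_klFun_eq_couplingKL hπ hη hη_pos]
  exact Finset.sum_nonneg fun i _ ↦ Finset.sum_nonneg fun j _ ↦
    mul_nonneg (hη_pos i j).le (klFun_nonneg (div_nonneg (hπ.1 i j) (hη_pos i j).le))

/-- Absolute continuity of the lifted laws passes to every pair of conditional laws charged by the
coupling. -/
lemma ac_of_liftedLaw_ac {Q R : Fin N₁ → Fin N₂ → Measure (PathSpace d)}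
    [∀ i j, SFinite (Q i j)] [∀ i j, SFinite (R i j)] (h : liftedLaw π Q ≪ liftedLaw η R)
    {i : Fin N₁} {j : Fin N₂} (hij : 0 < π i j) : Q i j ≪ R i j := by
  refine Measure.AbsolutelyContinuous.mk fun A hA hRA ↦ ?_
  have hs : MeasurableSet (({(i, j)} : Set (Fin N₁ × Fin N₂)) ×ˢ A) :=
    (measurableSet_singleton _).prod hA
  have hR0 : liftedLaw η R (({(i, j)} : Set (Fin N₁ × Fin N₂)) ×ˢ A) = 0 := by
    rw [liftedLaw_apply η R hs]
    refine Finset.sum_eq_zero fun i' _ ↦ Finset.sum_eq_zero fun j' _ ↦ ?_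
    by_cases hij' : (i', j') = (i, j)
    · obtain ⟨rfl, rfl⟩ := Prod.mk.inj hij'
      rw [Set.mk_preimage_prod_right (Set.mem_singleton _), hRA, mul_zero]
    · rw [Set.mk_preimage_prod_right_eq_empty (by simpa using hij'), measure_empty, mul_zero]
  have hQ0 := h hR0
  rw [liftedLaw_apply π Q hs, Finset.sum_eq_zero_iff] at hQ0
  have h1 := (Finset.sum_eq_zero_iff.1 (hQ0 i (Finset.mem_univ _))) j (Finset.mem_univ _)
  rw [Set.mk_preimage_prod_right (Set.mem_singleton _), mul_eq_zero] at h1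
  exact h1.resolve_left (by simpa using hij)

/-- The entropy decomposition of lifted laws: entropy of the coupling plus the average entropy of
the conditional laws. -/
theorem klDiv_liftedLaw (hπ : π ∈ couplings α₀ α₁) (hη : η ∈ couplings α₀ α₁)
    (hη_pos : ∀ i j, 0 < η i j) (Q R : Fin N₁ → Fin N₂ → Measure (PathSpace d))
    [∀ i j, IsProbabilityMeasure (Q i j)] [∀ i j, IsProbabilityMeasure (R i j)] :
    klDiv (liftedLaw π Q) (liftedLaw η R)
      = (∑ i, ∑ j, ENNReal.ofReal (π i j) * klDiv (Q i j) (R i j))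
        + ENNReal.ofReal (couplingKL π η) := by
  have := isFiniteMeasure_liftedLaw π Q
  have := isFiniteMeasure_liftedLaw η R
  by_cases hac : ∀ i j, 0 < π i j → Q i j ≪ R i j
  swap
  · -- both sides are infinite
    push Not at hac
    obtain ⟨i, j, hij, hnac⟩ := hac
    rw [klDiv_of_not_ac fun h ↦ hnac (ac_of_liftedLaw_ac h hij)]
    have htop : ENNReal.ofReal (π i j) * klDiv (Q i j) (R i j) = ∞ := by
      rw [klDiv_of_not_ac hnac, ENNReal.mul_top (by simpa using hij)]
    have hle : ENNReal.ofReal (π i j) * klDiv (Q i j) (R i j)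
        ≤ ∑ i, ∑ j, ENNReal.ofReal (π i j) * klDiv (Q i j) (R i j) :=
      (Finset.single_le_sum (f := fun j ↦ ENNReal.ofReal (π i j) * klDiv (Q i j) (R i j))
        (fun _ _ ↦ zero_le) (Finset.mem_univ j)).trans
      (Finset.single_le_sum (f := fun i ↦ ∑ j, ENNReal.ofReal (π i j) * klDiv (Q i j) (R i j))
        (fun _ _ ↦ zero_le) (Finset.mem_univ i))
    rw [htop, top_le_iff] at hle
    rw [hle, top_add]
  -- the density of the lifted law on the slice over `(i, j)` is `π i j / η i j` times the density of
  -- `Q i j`; where `π i j = 0` it vanishes, whether or not `Q i j` is absolutely continuous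
  set c : Fin N₁ × Fin N₂ → ℝ := fun p ↦ π p.1 p.2 / η p.1 p.2 with hc
  have hc0 : ∀ p, 0 ≤ c p := fun p ↦ div_nonneg (hπ.1 _ _) (hη_pos _ _).le
  set F : (Fin N₁ × Fin N₂) × PathSpace d → ℝ :=
    fun p ↦ c p.1 * ((Q p.1.1 p.1.2).rnDeriv (R p.1.1 p.1.2) p.2).toReal with hF
  have hF0 : ∀ p, 0 ≤ F p := fun p ↦ mul_nonneg (hc0 _) ENNReal.toReal_nonneg
  have hFm : Measurable F := measurable_from_prod_countable_right fun p ↦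
    (Measure.measurable_rnDeriv (Q p.1 p.2) (R p.1 p.2)).ennreal_toReal.const_mul (c p)
  have hdens : liftedLaw π Q
      = (liftedLaw η R).withDensity (fun p ↦ ENNReal.ofReal (F p)) := by
    ext s hs
    rw [withDensity_apply _ hs, ← lintegral_indicator hs,
      lintegral_liftedLaw η R (hFm.ennreal_ofReal.indicator hs), liftedLaw_apply π Q hs]
    refine Finset.sum_congr rfl fun i _ ↦ Finset.sum_congr rfl fun j _ ↦ ?_
    have hslice : ∫⁻ ω, s.indicator (fun p ↦ ENNReal.ofReal (F p)) ((i, j), ω) ∂(R i j)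
        = ENNReal.ofReal (c (i, j)) *
          (R i j).withDensity (fun ω ↦ ENNReal.ofReal ((Q i j).rnDeriv (R i j) ω).toReal)
            (Prod.mk (i, j) ⁻¹' s) := by
      rw [withDensity_apply _ (measurable_prodMk_left hs),
        ← lintegral_indicator (measurable_prodMk_left hs),
        ← lintegral_const_mul _ (Measurable.indicator
          (Measure.measurable_rnDeriv _ _).ennreal_toReal.ennreal_ofReal
          (measurable_prodMk_left hs))]
      refine lintegral_congr fun ω ↦ ?_
      by_cases hω : ((i, j), ω) ∈ s
      · simp [Set.indicator, hω, hF, ENNReal.ofReal_mul (hc0 _)]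
      · simp [Set.indicator, hω]
    rw [hslice, ← mul_assoc, ← ENNReal.ofReal_mul (hη_pos i j).le,
      show η i j * c (i, j) = π i j from mul_div_cancel₀ _ (hη_pos i j).ne']
    rcases (hπ.1 i j).eq_or_lt with h0 | hpos
    · simp [← h0]
    · rw [withDensity_ofReal_rnDeriv (hac i j hpos)]
  have hfin : IsFiniteMeasure ((liftedLaw η R).withDensity (fun p ↦ ENNReal.ofReal (F p))) := by
    rw [← hdens]; infer_instance
  rw [hdens, klDiv_withDensity _ hFm hF0, lintegral_liftedLaw η R (by fun_prop),
    ← sum_mul_klFun_eq_couplingKL hπ hη hη_pos,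
    ENNReal.ofReal_sum_of_nonneg fun i _ ↦ Finset.sum_nonneg fun j _ ↦
      mul_nonneg (hη_pos i j).le (klFun_nonneg (hc0 (i, j))), ← Finset.sum_add_distrib]
  refine Finset.sum_congr rfl fun i _ ↦ ?_
  rw [ENNReal.ofReal_sum_of_nonneg fun j _ ↦
      mul_nonneg (hη_pos i j).le (klFun_nonneg (hc0 (i, j))), ← Finset.sum_add_distrib]
  refine Finset.sum_congr rfl fun j _ ↦ ?_
  rw [ENNReal.ofReal_mul (hη_pos i j).le]
  rcases (hπ.1 i j).eq_or_lt with h0 | hpos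
  · simp [hF, hc, ← h0]
  · simp only [hF]
    rw [lintegral_klFun_const_mul (hac i j hpos) (hc0 (i, j)), mul_add, ← mul_assoc,
      ← ENNReal.ofReal_mul (hη_pos i j).le,
      show η i j * c (i, j) = π i j from mul_div_cancel₀ _ (hη_pos i j).ne']

/-! ### The finite-dimensional problem -/

lemma isCompact_couplings (α₀ : Fin N₁ → ℝ) (α₁ : Fin N₂ → ℝ) : IsCompact (couplings α₀ α₁) := by
  refine IsCompact.of_isClosed_subset
    (isCompact_univ_pi fun i ↦ isCompact_univ_pi fun _ : Fin N₂ ↦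
      isCompact_Icc (a := 0) (b := α₀ i))
    ?_ ?_
  · simp only [couplings, Set.ofPred_and, Set.ofPred_forall]
    refine (isClosed_iInter fun i ↦ isClosed_iInter fun j ↦ isClosed_le (by fun_prop)
      (by fun_prop)).inter ((isClosed_iInter fun i ↦ isClosed_eq (by fun_prop) (by fun_prop)).inter
      (isClosed_iInter fun i ↦ isClosed_eq (by fun_prop) (by fun_prop)))
  · intro π hπ i _ j _
    refine ⟨hπ.1 i j, ?_⟩
    rw [← hπ.2.1 i]
    exact Finset.single_le_sum (f := fun j ↦ π i j) (fun j _ ↦ hπ.1 i j) (Finset.mem_univ j)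

/-- Each summand is a rescaling of `x * log x`, which is continuous also at `0`. -/
lemma continuous_couplingKL (hη_pos : ∀ i j, 0 < η i j) :
    Continuous fun π : Fin N₁ → Fin N₂ → ℝ ↦ couplingKL π η := by
  refine continuous_finsetSum _ fun i _ ↦ continuous_finsetSum _ fun j _ ↦ ?_
  have h : (fun π : Fin N₁ → Fin N₂ → ℝ ↦ π i j * Real.log (π i j / η i j))
      = fun π ↦ η i j * ((fun x ↦ x * Real.log x) (π i j / η i j)) := by
    ext π
    have := (hη_pos i j).ne'
    field_simp
  rw [h]
  have hc := Real.continuous_mul_log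
  exact continuous_const.mul (hc.comp (by fun_prop))

lemma exists_isMinOn_couplings (κ : Fin N₁ → Fin N₂ → ℝ) (hη : η ∈ couplings α₀ α₁)
    (hη_pos : ∀ i j, 0 < η i j) :
    ∃ π ∈ couplings α₀ α₁, IsMinOn (fun π' ↦ (∑ i, ∑ j, π' i j * κ i j) + couplingKL π' η)
      (couplings α₀ α₁) π := by
  have hc := continuous_couplingKL hη_pos
  exact (isCompact_couplings α₀ α₁).exists_isMinOn ⟨η, hη⟩ (Continuous.continuousOn (by fun_prop))

end Lifted

/-! ### The lifted reduction -/

lemma ENNReal.eq_of_sum_le_sum {ι : Type*} [Fintype ι] {f g : ι → ℝ≥0∞} (h : ∀ i, f i ≤ g i)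
    (hle : ∑ i, g i ≤ ∑ i, f i) (hfin : ∑ i, f i ≠ ∞) (i : ι) : f i = g i := by
  have hg : ∀ i, g i ≠ ∞ := fun i ↦
    ENNReal.sum_ne_top.1 (ne_top_of_le_ne_top hfin hle) i (Finset.mem_univ i)
  have hf : ∀ i, f i ≠ ∞ := fun i ↦ ne_top_of_le_ne_top (hg i) (h i)
  have hsum : ∑ i, (f i).toReal = ∑ i, (g i).toReal := by
    rw [← ENNReal.toReal_sum fun i _ ↦ hf i, ← ENNReal.toReal_sum fun i _ ↦ hg i,
      le_antisymm hle (Finset.sum_le_sum fun i _ ↦ h i)]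
  exact (ENNReal.toReal_eq_toReal_iff' (hf i) (hg i)).1 ((Finset.sum_eq_sum_iff_of_le fun i _ ↦
    ENNReal.toReal_mono (hg i) (h i)).1 hsum i (Finset.mem_univ i))

section Reduction

variable {d N₁ N₂ : ℕ} {α₀ : Fin N₁ → ℝ} {α₁ : Fin N₂ → ℝ} {π η : Fin N₁ → Fin N₂ → ℝ}
  {p₀ : Fin N₁ → Measure (EuclideanSpace ℝ (Fin d))}
  {p₁ : Fin N₂ → Measure (EuclideanSpace ℝ (Fin d))}
  {R : Fin N₁ → Measure (PathSpace d)} {P Q : Fin N₁ → Fin N₂ → Measure (PathSpace d)}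

lemma liftedLaw_mem_admissibleLifts (hπ : π ∈ couplings α₀ α₁) (hQ : Q ∈ componentFamilies p₀ p₁) :
    liftedLaw π Q ∈ admissibleLifts α₀ α₁ p₀ p₁ := ⟨π, hπ, Q, hQ, rfl⟩

/-- For a fixed coupling, the entropy of the lifted law is smallest at the bridges. -/
lemma klDiv_liftedLaw_bridge_le [∀ i, IsProbabilityMeasure (R i)]
    (hη : η ∈ couplings α₀ α₁) (hη_pos : ∀ i j, 0 < η i j)
    (hP : ∀ i j, IsSchrodingerBridge (R i) (p₀ i) (p₁ j) (P i j))
    (hπ : π ∈ couplings α₀ α₁) (hQ : Q ∈ componentFamilies p₀ p₁) :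
    klDiv (liftedLaw π P) (liftedLaw η fun i _ ↦ R i)
      ≤ klDiv (liftedLaw π Q) (liftedLaw η fun i _ ↦ R i) := by
  have := fun i j ↦ (hP i j).1.1
  have := fun i j ↦ (hQ i j).1
  rw [klDiv_liftedLaw hπ hη hη_pos, klDiv_liftedLaw hπ hη hη_pos]
  gcongr with i _ j _
  exact (hP i j).2 (hQ i j)

/-- Along the bridges, the lifted entropy is the objective of the finite-dimensional problem. -/
lemma klDiv_liftedLaw_bridge [∀ i, IsProbabilityMeasure (R i)]
    (hη : η ∈ couplings α₀ α₁) (hη_pos : ∀ i j, 0 < η i j)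
    (hP : ∀ i j, P i j ∈ endpointLaws (p₀ i) (p₁ j)) (hfin : ∀ i j, klDiv (P i j) (R i) ≠ ∞)
    (hπ : π ∈ couplings α₀ α₁) :
    klDiv (liftedLaw π P) (liftedLaw η fun i _ ↦ R i)
      = ENNReal.ofReal ((∑ i, ∑ j, π i j * (klDiv (P i j) (R i)).toReal) + couplingKL π η) := by
  have := fun i j ↦ (hP i j).1
  have h0 : ∀ i j, 0 ≤ π i j * (klDiv (P i j) (R i)).toReal :=
    fun i j ↦ mul_nonneg (hπ.1 i j) ENNReal.toReal_nonneg
  rw [klDiv_liftedLaw hπ hη hη_pos, ENNReal.ofReal_add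
    (Finset.sum_nonneg fun i _ ↦ Finset.sum_nonneg fun j _ ↦ h0 i j)
    (couplingKL_nonneg hπ hη hη_pos),
    ENNReal.ofReal_sum_of_nonneg fun i _ ↦ Finset.sum_nonneg fun j _ ↦ h0 i j]
  congr 1
  refine Finset.sum_congr rfl fun i _ ↦ ?_
  rw [ENNReal.ofReal_sum_of_nonneg fun j _ ↦ h0 i j]
  refine Finset.sum_congr rfl fun j _ ↦ ?_
  rw [ENNReal.ofReal_mul (hπ.1 i j), ENNReal.ofReal_toReal (hfin i j)]

lemma objective_nonneg (hη : η ∈ couplings α₀ α₁) (hη_pos : ∀ i j, 0 < η i j)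
    {κ : Fin N₁ → Fin N₂ → ℝ} (hκ : ∀ i j, 0 ≤ κ i j) (hπ : π ∈ couplings α₀ α₁) :
    0 ≤ (∑ i, ∑ j, π i j * κ i j) + couplingKL π η :=
  add_nonneg (Finset.sum_nonneg fun i _ ↦ Finset.sum_nonneg fun j _ ↦
    mul_nonneg (hπ.1 i j) (hκ i j)) (couplingKL_nonneg hπ hη hη_pos)

/-- For a fixed coupling, a family minimizes the lifted entropy if and only if it agrees with the
bridges on the active pairs. -/
lemma isMinOn_klDiv_liftedLaw_iff [∀ i, IsProbabilityMeasure (R i)]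
    (hη : η ∈ couplings α₀ α₁) (hη_pos : ∀ i j, 0 < η i j)
    (hP : ∀ i j, IsSchrodingerBridge (R i) (p₀ i) (p₁ j) (P i j))
    (hfin : ∀ i j, klDiv (P i j) (R i) ≠ ∞) (hπ : π ∈ couplings α₀ α₁)
    (hQ : Q ∈ componentFamilies p₀ p₁) :
    IsMinOn (fun Q' ↦ klDiv (liftedLaw π Q') (liftedLaw η fun i _ ↦ R i))
      (componentFamilies p₀ p₁) Q ↔ ∀ i j, 0 < π i j → Q i j = P i j := by
  have := fun i j ↦ (hP i j).1.1
  have := fun i j ↦ (hQ i j).1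
  have hPmem : P ∈ componentFamilies p₀ p₁ := fun i j ↦ (hP i j).1
  constructor
  · intro hmin i j hij
    have hle : klDiv (liftedLaw π Q) (liftedLaw η fun i _ ↦ R i)
        ≤ klDiv (liftedLaw π P) (liftedLaw η fun i _ ↦ R i) := hmin hPmem
    rw [klDiv_liftedLaw hπ hη hη_pos, klDiv_liftedLaw hπ hη hη_pos,
      ENNReal.add_le_add_iff_right ENNReal.ofReal_ne_top] at hle
    simp only [← Fintype.sum_prod_type'
      (fun i j ↦ ENNReal.ofReal (π i j) * klDiv (_ : Measure (PathSpace d)) (R i))] at hle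
    have heq := ENNReal.eq_of_sum_le_sum
      (f := fun p : Fin N₁ × Fin N₂ ↦ ENNReal.ofReal (π p.1 p.2) * klDiv (P p.1 p.2) (R p.1))
      (g := fun p ↦ ENNReal.ofReal (π p.1 p.2) * klDiv (Q p.1 p.2) (R p.1))
      (fun p ↦ mul_le_mul_right ((hP p.1 p.2).2 (hQ p.1 p.2)) _) hle
      (ENNReal.sum_ne_top.2 fun p _ ↦ ENNReal.mul_ne_top ENNReal.ofReal_ne_top (hfin p.1 p.2))
      (i, j)
    have hkl : klDiv (P i j) (R i) = klDiv (Q i j) (R i) :=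
      (ENNReal.mul_right_inj (by simpa using hij) ENNReal.ofReal_ne_top).1 heq
    have hQb : IsSchrodingerBridge (R i) (p₀ i) (p₁ j) (Q i j) :=
      ⟨hQ i j, fun Q' hQ' ↦ hkl.symm.le.trans ((hP i j).2 hQ')⟩
    exact hQb.unique (hP i j) (hkl ▸ hfin i j)
  · intro hQP Q' hQ'
    refine le_trans (le_of_eq ?_) (klDiv_liftedLaw_bridge_le hη hη_pos hP hπ hQ')
    beta_reduce
    rw [klDiv_liftedLaw hπ hη hη_pos, klDiv_liftedLaw hπ hη hη_pos]
    congr 1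
    refine Finset.sum_congr rfl fun i _ ↦ Finset.sum_congr rfl fun j _ ↦ ?_
    rcases (hπ.1 i j).eq_or_lt with h0 | hpos
    · simp [← h0]
    · rw [hQP i j hpos]

end Reduction

theorem mainTheorem1 {d N₁ N₂ : ℕ} (ε : ℝ) (hε : 0 < ε)
    (α₀ : Fin N₁ → ℝ) (hα₀ : ∀ i, 0 < α₀ i) (hα₀_sum : ∑ i, α₀ i = 1)
    (α₁ : Fin N₂ → ℝ) (hα₁ : ∀ j, 0 < α₁ j) (hα₁_sum : ∑ j, α₁ j = 1)
    (m₀ : Fin N₁ → EuclideanSpace ℝ (Fin d)) (S₀ : Fin N₁ → Matrix (Fin d) (Fin d) ℝ)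
    (hS₀ : ∀ i, (S₀ i).PosDef)
    (m₁ : Fin N₂ → EuclideanSpace ℝ (Fin d)) (S₁ : Fin N₂ → Matrix (Fin d) (Fin d) ℝ)
    (hS₁ : ∀ j, (S₁ j).PosDef)
    (p₀ : Fin N₁ → Measure (EuclideanSpace ℝ (Fin d)))
    (hp₀ : ∀ i, p₀ i = multivariateGaussian (m₀ i) (S₀ i))
    (p₁ : Fin N₂ → Measure (EuclideanSpace ℝ (Fin d)))
    (hp₁ : ∀ j, p₁ j = multivariateGaussian (m₁ j) (S₁ j))
    (R : Fin N₁ → Measure (PathSpace d)) (hR : ∀ i, IsUncontrolledLaw ε (p₀ i) (R i))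
    (η : Fin N₁ → Fin N₂ → ℝ) (hη : η ∈ couplings α₀ α₁) (hη_pos : ∀ i j, 0 < η i j)
    (Rbar : Measure ((Fin N₁ × Fin N₂) × PathSpace d))
    (hRbar : Rbar = liftedLaw η (fun i _ ↦ R i)) :
    -- the pairwise bridges exist and are unique
    (∀ i j, ∃! P, IsSchrodingerBridge (R i) (p₀ i) (p₁ j) P) ∧
    ∀ P : Fin N₁ → Fin N₂ → Measure (PathSpace d),
      (∀ i j, IsSchrodingerBridge (R i) (p₀ i) (p₁ j) (P i j)) →
      -- their entropies are finite
      (∀ i j, klDiv (P i j) (R i) ≠ ∞) ∧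
      ∀ κ C : Fin N₁ → Fin N₂ → ℝ,
        (∀ i j, κ i j = (klDiv (P i j) (R i)).toReal) →
        (∀ i j, C i j = ε * κ i j) →
        -- the lifted infimum, and its form in energy scaling
        (⨅ Qbar ∈ admissibleLifts α₀ α₁ p₀ p₁, (klDiv Qbar Rbar : EReal)) =
          (⨅ π ∈ couplings α₀ α₁,
            (((∑ i, ∑ j, π i j * κ i j) + couplingKL π η : ℝ) : EReal)) ∧
        (⨅ Qbar ∈ admissibleLifts α₀ α₁ p₀ p₁, (ε : EReal) * (klDiv Qbar Rbar : EReal)) =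
          (⨅ π ∈ couplings α₀ α₁,
            (((∑ i, ∑ j, π i j * C i j) + ε * couplingKL π η : ℝ) : EReal)) ∧
        -- the finite-dimensional infimum is attained
        (∃ π ∈ couplings α₀ α₁,
          IsMinOn (fun π' ↦ (∑ i, ∑ j, π' i j * κ i j) + couplingKL π' η)
            (couplings α₀ α₁) π) ∧
        -- for a fixed coupling, the optimal conditional laws on active pairs are the bridges
        (∀ π ∈ couplings α₀ α₁, ∀ Q ∈ componentFamilies p₀ p₁,
          (IsMinOn (fun Q' ↦ klDiv (liftedLaw π Q') Rbar) (componentFamilies p₀ p₁) Q ↔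
            ∀ i j, 0 < π i j → Q i j = P i j)) ∧
        -- optimal couplings give optimal lifted laws
        (∀ π ∈ couplings α₀ α₁,
          IsMinOn (fun π' ↦ (∑ i, ∑ j, π' i j * κ i j) + couplingKL π' η)
            (couplings α₀ α₁) π →
          liftedLaw π P ∈ admissibleLifts α₀ α₁ p₀ p₁ ∧
          IsMinOn (fun Qbar ↦ klDiv Qbar Rbar) (admissibleLifts α₀ α₁ p₀ p₁) (liftedLaw π P) ∧
          -- with unique conditional laws if every pair is active
          ((∀ i j, 0 < π i j) → ∀ Q ∈ componentFamilies p₀ p₁,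
            IsMinOn (fun Qbar ↦ klDiv Qbar Rbar) (admissibleLifts α₀ α₁ p₀ p₁) (liftedLaw π Q) →
            ∀ i j, Q i j = P i j)) := by
  have hRp : ∀ i, IsProbabilityMeasure (R i) := fun i ↦ (hR i).isProbabilityMeasure
  have hex : ∀ i j, ∃ P, IsSchrodingerBridge (R i) (p₀ i) (p₁ j) P ∧ klDiv P (R i) ≠ ∞ := by
    intro i j
    have hRi := hR i
    rw [hp₀ i] at hRi ⊢
    rw [hp₁ j]
    exact exists_isSchrodingerBridge hε (hS₁ j) hRi
  refine ⟨fun i j ↦ ?_, fun P hP ↦ ?_⟩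
  · obtain ⟨P, hP, hfin⟩ := hex i j
    exact ⟨P, hP, fun P' hP' ↦ (hP.unique hP' hfin).symm⟩
  have hfin : ∀ i j, klDiv (P i j) (R i) ≠ ∞ := fun i j ↦ by
    obtain ⟨P', hP', hfin'⟩ := hex i j
    exact (hP i j).klDiv_eq hP' ▸ hfin'
  refine ⟨hfin, fun κ C hκ hC ↦ ?_⟩
  subst hRbar
  have hPmem : P ∈ componentFamilies p₀ p₁ := fun i j ↦ (hP i j).1
  have hκ0 : ∀ i j, 0 ≤ κ i j := fun i j ↦ hκ i j ▸ ENNReal.toReal_nonneg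
  have hval : ∀ π ∈ couplings α₀ α₁, klDiv (liftedLaw π P) (liftedLaw η fun i _ ↦ R i)
      = ENNReal.ofReal ((∑ i, ∑ j, π i j * κ i j) + couplingKL π η) := by
    intro π hπ
    simp_rw [hκ]
    exact klDiv_liftedLaw_bridge hη hη_pos hPmem hfin hπ
  have hvalE : ∀ π ∈ couplings α₀ α₁,
      (klDiv (liftedLaw π P) (liftedLaw η fun i _ ↦ R i) : EReal)
        = (((∑ i, ∑ j, π i j * κ i j) + couplingKL π η : ℝ) : EReal) := by
    intro π hπ
    rw [hval π hπ, EReal.coe_ennreal_ofReal, max_eq_left (objective_nonneg hη hη_pos hκ0 hπ)]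
  have hscale : ∀ π : Fin N₁ → Fin N₂ → ℝ, (∑ i, ∑ j, π i j * C i j) + ε * couplingKL π η
      = ε * ((∑ i, ∑ j, π i j * κ i j) + couplingKL π η) := by
    intro π
    simp_rw [hC, mul_add, Finset.mul_sum]
    congr 1
    exact Finset.sum_congr rfl fun i _ ↦ Finset.sum_congr rfl fun j _ ↦ by ring
  refine ⟨?_, ?_, exists_isMinOn_couplings κ hη hη_pos,
    fun π hπ Q hQ ↦ isMinOn_klDiv_liftedLaw_iff hη hη_pos hP hfin hπ hQ, fun π hπ hmin ↦ ?_⟩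
  · refine le_antisymm (le_iInf₂ fun π hπ ↦ ?_) (le_iInf₂ fun Qbar hQbar ↦ ?_)
    · exact iInf₂_le_of_le _ (liftedLaw_mem_admissibleLifts hπ hPmem) (hvalE π hπ).le
    · obtain ⟨π, hπ, Q, hQ, rfl⟩ := hQbar
      refine iInf₂_le_of_le π hπ ?_
      rw [← hvalE π hπ]
      exact_mod_cast klDiv_liftedLaw_bridge_le hη hη_pos hP hπ hQ
  · refine le_antisymm (le_iInf₂ fun π hπ ↦ ?_) (le_iInf₂ fun Qbar hQbar ↦ ?_)
    · refine iInf₂_le_of_le _ (liftedLaw_mem_admissibleLifts hπ hPmem) ?_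
      rw [hvalE π hπ, hscale, EReal.coe_mul]
    · obtain ⟨π, hπ, Q, hQ, rfl⟩ := hQbar
      refine iInf₂_le_of_le π hπ ?_
      rw [hscale, EReal.coe_mul, ← hvalE π hπ]
      refine mul_le_mul_of_nonneg_left ?_ (by exact_mod_cast hε.le)
      exact_mod_cast klDiv_liftedLaw_bridge_le hη hη_pos hP hπ hQ
  · have hlift : IsMinOn (fun Qbar ↦ klDiv Qbar (liftedLaw η fun i _ ↦ R i))
        (admissibleLifts α₀ α₁ p₀ p₁) (liftedLaw π P) := by
      rintro Qbar ⟨π', hπ', Q', hQ', rfl⟩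
      refine le_trans ?_ (klDiv_liftedLaw_bridge_le hη hη_pos hP hπ' hQ')
      beta_reduce
      rw [hval π hπ, hval π' hπ']
      exact ENNReal.ofReal_le_ofReal (hmin hπ')
    refine ⟨liftedLaw_mem_admissibleLifts hπ hPmem, hlift, fun hpos Q hQ hQmin i j ↦ ?_⟩
    exact (isMinOn_klDiv_liftedLaw_iff hη hη_pos hP hfin hπ hQ).1
      (fun Q' hQ' ↦ hQmin (liftedLaw_mem_admissibleLifts hπ hQ')) i j (hpos i j)
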